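/- Let $\tau_1,\tau_2,\dots$ and $J_1,J_2,\dots$ be mutually independent, almost surely positive random variables on a probability space; the sojourn times $\tau_n$ have common probability density $\psi$ (with distribution function $\Psi(t)=\int_0^t\psi(t')\,dt'$) and the jumps $J_n$ have common probability density $h$. Put $t_0=0$, $t_n=\tau_1+\dots+\tau_n$, $S_t=\sum_{n\ge 1}J_n\,\theta(t-t_n)$ with $\theta(u)=1$ for $u\ge 0$ and $\theta(u)=0$ for $u<0$, and let $N_t=\#\{n\ge 1: t_n\le t\}$. Let $v>0$ and $b>0$. For $r\ge 0$, the drifting continuous-time random walk with present state $X_r=x$ is $X_t=x+v(t-r)+S_t-S_r$, $t\ge r$, where the law of the $\tau_n$ and $J_n$ is the unconditioned one (the past of the walk, including its starting point, is not observed). Let $\mathbf t_b^{x,r}=\inf\{s\ge 0: X_{r+s}\notin(0,b)\}$ and $T_b(x,r)=\mathbb E[\mathbf t_b^{x,r}]$. Let $\mathcal T_b(x)$ be the mean exit time after a jump, i.e. the expectation of the exit time from $(0,b)$ counted from a jump time $t_n$ ($n\ge 0$), for the walk whose state at $t_n$ is $x$. Let $E_r=t_{N_r+1}-r$ be the excess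 life at $r$, $\Phi(l|r)=\mathbb P\{E_r\le l\}$ and $\phi(l|r)=\partial_l\Phi(l|r)$. For $x\in(0,b)$ write $\varrho=(b-x)/v$. Then: 1. For every $x\in(0,b)$, the exit time after a jump is integrable, its mean $\mathcal T_b(x)$ does not depend on $n$, and it satisfies, with all integrals convergent, $$\mathcal T_b(x)=\int_0^{\varrho}\bigl[1-\Psi(l)\bigr]\,dl+\frac1v\int_0^{v\varrho}\psi\Bigl(\varrho-\frac zv\Bigr)\int_0^z h(u)\,\mathcal T_b(b-z+u)\,du\,dz .$$ 2. For every $r\ge 0$, the function $\phi(\cdot|r)$ (which exists almost everywhere) is a density of $E_r$: $\Phi(l|r)=\int_0^l\phi(s|r)\,ds$ for all $l\ge 0$. 3. For every $r\ge 0$ and $x\in(0,b)$, $\mathbf t_b^{x,r}$ is integrable and, with all integrals convergent, $$T_b(x,r)=\int_0^{\varrho}\bigl[1-\Phi(l|r)\bigr]\,dl+\frac1v\int_0^{v\varrho}\phi\Bigl(\varrho-\frac zv\Bigm|r\Bigr)\int_0^z h(u)\,\mathcal T_b(b-z+u)\,du\,dz .$$ -/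

import Mathlib

open MeasureTheory

noncomputable section

namespace CTRW

variable {Ω : Type*}

/-- The `n`-th jump time `t_n = τ_1 + ⋯ + τ_n`, with `t_0 = 0`. The sojourn time `τ_{i+1}` is
stored as `τ i`. -/
def jumpTime (τ : ℕ → Ω → ℝ) (n : ℕ) (ω : Ω) : ℝ :=
  ∑ i ∈ Finset.range n, τ i ω

/-- The jump part `S_t = ∑_{n ≥ 1} J_n θ(t - t_n)`, with `θ(u) = 1` for `u ≥ 0` and `θ(u) = 0`
for `u < 0`. The jump `J_{n+1}` is stored as `J n` and occurs at time `t_{n+1}`. -/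
def jumpPart (τ J : ℕ → Ω → ℝ) (t : ℝ) (ω : Ω) : ℝ :=
  ∑' n : ℕ, if jumpTime τ (n + 1) ω ≤ t then J n ω else 0

/-- The drifting random walk whose state at the present time `r` is `x`:
`X_t = x + v (t - r) + (S_t - S_r)`. -/
def process (v : ℝ) (τ J : ℕ → Ω → ℝ) (r x t : ℝ) (ω : Ω) : ℝ :=
  x + v * (t - r) + (jumpPart τ J t ω - jumpPart τ J r ω)

/-- The time elapsed from `r` until the walk with `X_r = x` first leaves `(0, b)`. -/
def exitTime (v b : ℝ) (τ J : ℕ → Ω → ℝ) (r x : ℝ) (ω : Ω) : ℝ :=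
  sInf {s : ℝ | 0 ≤ s ∧ process v τ J r x (r + s) ω ∉ Set.Ioo 0 b}

/-- The exit time counted from the `n`-th jump time `t_n`, the state right after that jump
being `x`. -/
def exitTimeAfterJump (v b : ℝ) (τ J : ℕ → Ω → ℝ) (n : ℕ) (x : ℝ) (ω : Ω) : ℝ :=
  exitTime v b τ J (jumpTime τ n ω) x ω

/-- The number `N_t` of jumps up to and including time `t`. -/
def jumpCount (τ : ℕ → Ω → ℝ) (t : ℝ) (ω : Ω) : ℕ :=
  {n : ℕ | 1 ≤ n ∧ jumpTime τ n ω ≤ t}.ncard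

/-- The excess life `E_r = t_{N_r + 1} - r`. -/
def excessLife (τ : ℕ → Ω → ℝ) (r : ℝ) (ω : Ω) : ℝ :=
  jumpTime τ (jumpCount τ r ω + 1) ω - r

variable [MeasurableSpace Ω]

/-- The mean exit time `T_b(x, r)` from an arbitrary present time `r`. -/
def meanExitTime (P : Measure Ω) (v b : ℝ) (τ J : ℕ → Ω → ℝ) (x r : ℝ) : ℝ :=
  ∫ ω, exitTime v b τ J r x ω ∂P

/-- The mean exit time after the `n`-th jump. -/
def meanExitTimeAfterJump (P : Measure Ω) (v b : ℝ) (τ J : ℕ → Ω → ℝ) (n : ℕ) (x : ℝ) : ℝ :=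
  ∫ ω, exitTimeAfterJump v b τ J n x ω ∂P

/-- The distribution function `Φ(l|r) = P(E_r ≤ l)` of the excess life. -/
def excessCDF (P : Measure Ω) (τ : ℕ → Ω → ℝ) (r l : ℝ) : ℝ :=
  P.real {ω | excessLife τ r ω ≤ l}

/-- The density `φ(l|r) = ∂Φ(l|r)/∂l` of the excess life. -/
def excessPDF (P : Measure Ω) (τ : ℕ → Ω → ℝ) (r l : ℝ) : ℝ :=
  deriv (fun t => excessCDF P τ r t) l

/-- The distribution function `∫₀ᵗ ψ` of a positive random variable with density `ψ`. -/
def densityCDF (ψ : ℝ → ℝ) (t : ℝ) : ℝ :=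
  ∫ s in (0 : ℝ)..t, ψ s

end CTRW

end

namespace CTRW

/-! Drift and jumps both push upwards, so a walk started at `x ∈ (0, b)` can leave only through `b`,
and does so no later than `ρ = (b - x) / v`. Let `e` be the waiting time from the present to the
next jump. If `e ≥ ρ`, the exit time is `ρ`; otherwise it is `e` plus the exit time of the walk
restarted from the post-jump state `x + v e + J`. This pathwise identity is
`Admissible.exitTime_decomp`.

Taking expectations requires the waiting time, the jump that ends it and the path after that jump to
have a product law. The mean of `min e ρ` is then the integral of the survival function, and Fubini
with the substitution `z = b - x - v e` turns the remainder into the double integral.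
`integral_decomp_eq` does this for an arbitrary waiting law with a density, so the two formulas are
one computation, applied to the law of `τ n` and to the law of the excess life.

Three probabilistic inputs remain. Jump times tend to infinity almost surely
(`ae_tendsto_jumpTime`). The post-jump exit time is a measurable functional `pathExit` of the
subsequent path, whose law is the same after every jump. Splitting over the value of `N_r` shows
that the excess life is independent of what follows it (`map_excessTriple`) and absolutely
continuous, hence has the derivative of its distribution function as a density. -/

/-- Deterministic admissibility of a path: positive sojourn times and jumps, and jump times
tending to infinity. -/
structure Admissible {Ω : Type*} (τ J : ℕ → Ω → ℝ) (ω : Ω) : Prop where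
  sojourn_pos : ∀ n, 0 < τ n ω
  jump_pos : ∀ n, 0 < J n ω
  tendsto_jumpTime : Filter.Tendsto (fun n => jumpTime τ n ω) Filter.atTop Filter.atTop

/-! ### Pathwise analysis of the exit time -/

section Path

variable {Ω : Type*} {τ J : ℕ → Ω → ℝ} {ω : Ω}

@[simp] lemma jumpTime_zero : jumpTime τ 0 ω = 0 := by simp [jumpTime]

lemma jumpTime_succ (n : ℕ) : jumpTime τ (n + 1) ω = jumpTime τ n ω + τ n ω := by
  simp [jumpTime, Finset.sum_range_succ]

lemma exitTime_nonneg {v b r x : ℝ} : 0 ≤ exitTime v b τ J r x ω :=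
  Real.sInf_nonneg fun _ hs => hs.1

namespace Admissible

variable (H : Admissible τ J ω)
include H

lemma strictMono_jumpTime : StrictMono fun n => jumpTime τ n ω :=
  strictMono_nat_of_lt_succ fun n => by
    have := H.sojourn_pos n
    simp only [jumpTime_succ]; linarith

lemma jumpTime_nonneg (n : ℕ) : 0 ≤ jumpTime τ n ω := by
  simpa using H.strictMono_jumpTime.monotone (Nat.zero_le n)

lemma exists_between {t : ℝ} (ht : 0 ≤ t) :
    ∃ n, jumpTime τ n ω ≤ t ∧ t < jumpTime τ (n + 1) ω := by
  classical
  have hex : ∃ n, t < jumpTime τ n ω :=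
    (H.tendsto_jumpTime.eventually_gt_atTop t).exists
  have h0 : Nat.find hex ≠ 0 := fun h => by
    have := Nat.find_spec hex
    rw [h, jumpTime_zero] at this
    linarith
  obtain ⟨n, hn⟩ := Nat.exists_eq_succ_of_ne_zero h0
  refine ⟨n, not_lt.1 (Nat.find_min hex (by omega)), ?_⟩
  have := Nat.find_spec hex
  rwa [hn] at this

lemma jumpTime_le_iff {n i : ℕ} {t : ℝ} (h₁ : jumpTime τ n ω ≤ t)
    (h₂ : t < jumpTime τ (n + 1) ω) : jumpTime τ i ω ≤ t ↔ i ≤ n := by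
  constructor
  · intro hi
    have := H.strictMono_jumpTime.lt_iff_lt.1 (hi.trans_lt h₂)
    omega
  · exact fun hi => (H.strictMono_jumpTime.monotone hi).trans h₁

lemma jumpCount_eq {n : ℕ} {t : ℝ} (h₁ : jumpTime τ n ω ≤ t)
    (h₂ : t < jumpTime τ (n + 1) ω) : jumpCount τ t ω = n := by
  have : {i : ℕ | 1 ≤ i ∧ jumpTime τ i ω ≤ t} = (Finset.Icc 1 n : Finset ℕ) := by
    ext i
    simp [H.jumpTime_le_iff h₁ h₂]
  rw [jumpCount, this, Set.ncard_coe_finset]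
  simp

lemma excessLife_eq {n : ℕ} {t : ℝ} (h₁ : jumpTime τ n ω ≤ t)
    (h₂ : t < jumpTime τ (n + 1) ω) : excessLife τ t ω = jumpTime τ (n + 1) ω - t := by
  rw [excessLife, H.jumpCount_eq h₁ h₂]

lemma jumpPart_eq {n : ℕ} {t : ℝ} (h₁ : jumpTime τ n ω ≤ t)
    (h₂ : t < jumpTime τ (n + 1) ω) : jumpPart τ J t ω = ∑ i ∈ Finset.range n, J i ω := by
  rw [jumpPart, tsum_eq_sum (s := Finset.range n)]
  · refine Finset.sum_congr rfl fun i hi => if_pos ?_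
    rw [H.jumpTime_le_iff h₁ h₂]
    exact Nat.succ_le_of_lt (Finset.mem_range.1 hi)
  · intro i hi
    refine if_neg ?_
    rw [H.jumpTime_le_iff h₁ h₂]
    simpa using hi

lemma jumpPart_mono {s t : ℝ} (hs : 0 ≤ s) (hst : s ≤ t) :
    jumpPart τ J s ω ≤ jumpPart τ J t ω := by
  obtain ⟨m, hm₁, hm₂⟩ := H.exists_between hs
  obtain ⟨n, hn₁, hn₂⟩ := H.exists_between (hs.trans hst)
  rw [H.jumpPart_eq hm₁ hm₂, H.jumpPart_eq hn₁ hn₂]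
  refine Finset.sum_le_sum_of_subset_of_nonneg ?_ fun i _ _ => (H.jump_pos i).le
  have := (H.jumpTime_le_iff hn₁ hn₂).1 (hm₁.trans hst)
  simpa using this

/-- The path never goes below its positive starting level, so only the upper barrier matters. -/
lemma notMem_Ioo_iff {v b r x s : ℝ} (hv : 0 < v) (hr : 0 ≤ r) (hx : 0 < x) (hs : 0 ≤ s) :
    process v τ J r x (r + s) ω ∉ Set.Ioo 0 b ↔
      b ≤ x + v * s + (jumpPart τ J (r + s) ω - jumpPart τ J r ω) := by
  have h := H.jumpPart_mono hr (le_add_of_nonneg_right hs)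
  have : 0 ≤ v * s := by positivity
  simp only [process, Set.mem_Ioo, add_sub_cancel_left]
  grind

lemma exitSet_mem {v b r x : ℝ} (hv : 0 < v) (hr : 0 ≤ r) (hx : 0 < x) :
    max 0 ((b - x) / v) ∈
      {s : ℝ | 0 ≤ s ∧ process v τ J r x (r + s) ω ∉ Set.Ioo 0 b} := by
  refine ⟨le_max_left _ _, ?_⟩
  rw [H.notMem_Ioo_iff hv hr hx (le_max_left _ _)]
  have h := H.jumpPart_mono hr (le_add_of_nonneg_right (le_max_left 0 ((b - x) / v)))
  have h2 : (b - x) / v ≤ max 0 ((b - x) / v) := le_max_right _ _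
  rw [div_le_iff₀ hv] at h2
  linarith

lemma exitTime_le {v b r x : ℝ} (hv : 0 < v) (hr : 0 ≤ r) (hx : 0 < x) :
    exitTime v b τ J r x ω ≤ max 0 ((b - x) / v) :=
  csInf_le ⟨0, fun _ hs => hs.1⟩ (H.exitSet_mem hv hr hx)

lemma exitTime_of_le {v b r x : ℝ} (hv : 0 < v) (hr : 0 ≤ r) (hx : 0 < x) (hb : b ≤ x) :
    exitTime v b τ J r x ω = 0 := by
  refine le_antisymm ?_ exitTime_nonneg
  have := H.exitTime_le (b := b) hv hr hx
  rwa [max_eq_left] at this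
  exact div_nonpos_of_nonpos_of_nonneg (by linarith) hv.le

/-- Decomposition of the exit time at the first jump after the present time `r`. -/
lemma exitTime_decomp {v b r x : ℝ} (hv : 0 < v) (hx : x ∈ Set.Ioo 0 b) {n : ℕ}
    (h₁ : jumpTime τ n ω ≤ r) (h₂ : r < jumpTime τ (n + 1) ω) :
    exitTime v b τ J r x ω =
      min (jumpTime τ (n + 1) ω - r) ((b - x) / v) +
        if jumpTime τ (n + 1) ω - r < (b - x) / v then
          exitTimeAfterJump v b τ J (n + 1) (x + v * (jumpTime τ (n + 1) ω - r) + J n ω) ω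
        else 0 := by
  obtain ⟨hx0, hxb⟩ := hx
  have hr : 0 ≤ r := (H.jumpTime_nonneg n).trans h₁
  set e := jumpTime τ (n + 1) ω - r with he
  have he0 : 0 < e := by linarith
  have hre : r + e = jumpTime τ (n + 1) ω := by linarith
  have hρ : 0 < (b - x) / v := div_pos (by linarith) hv
  -- Before the next jump the jump part is constant, so only the drift moves the walk, and it needs
  -- time `(b - x) / v` to reach `b`.
  have hlow : ∀ s, 0 ≤ s → s < e → s < (b - x) / v →
      process v τ J r x (r + s) ω ∈ Set.Ioo 0 b := by
    intro s hs hse hsρ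
    by_contra hcon
    rw [H.notMem_Ioo_iff hv hr hx0 hs, H.jumpPart_eq h₁ h₂,
      H.jumpPart_eq (n := n) (by linarith) (by linarith)] at hcon
    rw [lt_div_iff₀ hv] at hsρ
    linarith
  by_cases hcase : e < (b - x) / v
  · rw [if_pos hcase, min_eq_left hcase.le]
    set x' := x + v * e + J n ω with hx'
    have hx'0 : 0 < x' := by
      have := H.jump_pos n
      positivity
    have hSr : jumpPart τ J (jumpTime τ (n + 1) ω) ω = jumpPart τ J r ω + J n ω := by
      rw [H.jumpPart_eq h₁ h₂, H.jumpPart_eq (n := n + 1) le_rfl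
        (H.strictMono_jumpTime (Nat.lt_succ_self _)), Finset.sum_range_succ]
    -- From the jump time on, the walk coincides with the one restarted at `x'`; the exit sets are
    -- translates of each other by `e`.
    have hshift : ∀ s, 0 ≤ s → (process v τ J r x (r + (e + s)) ω ∉ Set.Ioo 0 b ↔
        process v τ J (jumpTime τ (n + 1) ω) x' (jumpTime τ (n + 1) ω + s) ω
          ∉ Set.Ioo 0 b) := by
      intro s hs
      have : process v τ J r x (r + (e + s)) ω =
          process v τ J (jumpTime τ (n + 1) ω) x' (jumpTime τ (n + 1) ω + s) ω := by
        simp only [process]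
        rw [hSr, ← add_assoc, hre, hx', he]
        ring
      rw [this]
    apply le_antisymm
    · rw [← sub_le_iff_le_add']
      refine le_csInf ⟨_, H.exitSet_mem hv (H.jumpTime_nonneg _) hx'0⟩ fun s hs => ?_
      rw [sub_le_iff_le_add']
      exact csInf_le ⟨0, fun _ hs => hs.1⟩
        ⟨by linarith [hs.1], (hshift s hs.1).2 hs.2⟩
    · refine le_csInf ⟨_, H.exitSet_mem hv hr hx0⟩ fun s hs => ?_
      have hes : e ≤ s := by
        by_contra! hcon
        exact hs.2 (hlow s hs.1 hcon (hcon.trans hcase))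
      rw [← le_sub_iff_add_le']
      refine csInf_le ⟨0, fun _ hs => hs.1⟩ ⟨by linarith, ?_⟩
      rw [← hshift _ (by linarith), add_sub_cancel]
      exact hs.2
  · rw [if_neg hcase, add_zero, min_eq_right (not_lt.1 hcase)]
    apply le_antisymm
    · have := H.exitTime_le (b := b) hv hr hx0
      rwa [max_eq_right hρ.le] at this
    · refine le_csInf ⟨_, H.exitSet_mem hv hr hx0⟩ fun s hs => ?_
      by_contra! hcon
      exact hs.2 (hlow s hs.1 (by linarith) hcon)

end Admissible

end Path

/-! ### The exit time as a measurable functional of the path -/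

/-- The sequences of sojourn times and of jumps following the `n`-th jump. -/
def pathAfter {Ω : Type*} (τ J : ℕ → Ω → ℝ) (n : ℕ) (ω : Ω) : (ℕ → ℝ) × (ℕ → ℝ) :=
  (fun i => τ (n + i) ω, fun i => J (n + i) ω)

/-- The exit time after a jump, as far as the first `k` sojourn times determine it. -/
noncomputable def exitApprox (v b : ℝ) : ℕ → (ℕ → ℝ) × (ℕ → ℝ) → ℝ → ℝ
  | 0, _, _ => 0
  | k + 1, p, x => if x < b then min (p.1 0) ((b - x) / v) +
      (if p.1 0 < (b - x) / v then
        exitApprox v b k (fun i => p.1 (i + 1), fun i => p.2 (i + 1)) (x + v * p.1 0 + p.2 0)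
      else 0) else 0

/-- The exit time after a jump as a jointly measurable function of the subsequent path and of the
state, clipped so as to be bounded and to vanish outside `(0, b)`. -/
noncomputable def pathExit (v b : ℝ) (p : (ℕ → ℝ) × (ℕ → ℝ)) (x : ℝ) : ℝ :=
  if x ∈ Set.Ioo 0 b then
    max 0 (min (b / v) (Filter.limsup (fun k => exitApprox v b k p x) Filter.atTop)) else 0

lemma measurable_exitApprox (v b : ℝ) (k : ℕ) :
    Measurable fun q : ((ℕ → ℝ) × (ℕ → ℝ)) × ℝ => exitApprox v b k q.1 q.2 := by
  induction k with
  | zero => exact measurable_const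
  | succ k ih =>
    have hstep : Measurable fun q : ((ℕ → ℝ) × (ℕ → ℝ)) × ℝ =>
        (((fun i => q.1.1 (i + 1), fun i => q.1.2 (i + 1)), q.2 + v * q.1.1 0 + q.1.2 0) :
          ((ℕ → ℝ) × (ℕ → ℝ)) × ℝ) := by
      fun_prop
    simp only [exitApprox]
    refine Measurable.ite (measurableSet_lt measurable_snd measurable_const)
      (Measurable.add (by fun_prop) (Measurable.ite (measurableSet_lt (by fun_prop)
        (by fun_prop)) (ih.comp hstep) measurable_const)) measurable_const

lemma measurable_pathExit (v b : ℝ) :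
    Measurable fun q : ((ℕ → ℝ) × (ℕ → ℝ)) × ℝ => pathExit v b q.1 q.2 := by
  have h : Measurable fun q : ((ℕ → ℝ) × (ℕ → ℝ)) × ℝ =>
      Filter.limsup (fun k => exitApprox v b k q.1 q.2) Filter.atTop :=
    Measurable.limsup fun k => measurable_exitApprox v b k
  exact Measurable.ite (measurable_snd measurableSet_Ioo)
    (measurable_const.max (measurable_const.min h)) measurable_const

lemma pathExit_nonneg (v b : ℝ) (p : (ℕ → ℝ) × (ℕ → ℝ)) (x : ℝ) : 0 ≤ pathExit v b p x := by
  unfold pathExit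
  split_ifs
  exacts [le_max_left _ _, le_rfl]

lemma pathExit_le {v : ℝ} (hv : 0 < v) (b : ℝ) (p : (ℕ → ℝ) × (ℕ → ℝ)) (x : ℝ) :
    pathExit v b p x ≤ |b| / v := by
  unfold pathExit
  split_ifs
  · refine max_le (by positivity) ((min_le_left _ _).trans ?_)
    gcongr
    exact le_abs_self b
  · positivity

lemma pathExit_of_le {v b x : ℝ} (p : (ℕ → ℝ) × (ℕ → ℝ)) (hx : b ≤ x) : pathExit v b p x = 0 :=
  if_neg fun h => absurd h.2 (not_lt.2 hx)

namespace Admissible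

variable {Ω : Type*} {τ J : ℕ → Ω → ℝ} {ω : Ω} (H : Admissible τ J ω)
include H

/-- Once `k` sojourns cover the time in which drift alone reaches `b`, later data are irrelevant.
The induction closes because a jump raises the state, so the remaining horizon shrinks by at least
the sojourn just used. -/
lemma exitTimeAfterJump_eq_exitApprox {v b : ℝ} (hv : 0 < v) (k n : ℕ) {x : ℝ} (hx : 0 < x)
    (hk : (b - x) / v ≤ jumpTime τ (n + k) ω - jumpTime τ n ω) :
    exitTimeAfterJump v b τ J n x ω = exitApprox v b k (pathAfter τ J n ω) x := by
  induction k generalizing n x with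
  | zero =>
    rw [add_zero, sub_self, div_le_iff₀ hv] at hk
    exact H.exitTime_of_le hv (H.jumpTime_nonneg n) hx (by linarith)
  | succ k ih =>
    simp only [exitApprox]
    by_cases hxb : x < b
    · have he : jumpTime τ (n + 1) ω - jumpTime τ n ω = τ n ω := by
        rw [jumpTime_succ]; ring
      have h0 : (pathAfter τ J n ω).1 0 = τ n ω := rfl
      have h0' : (pathAfter τ J n ω).2 0 = J n ω := rfl
      rw [if_pos hxb, exitTimeAfterJump, H.exitTime_decomp hv ⟨hx, hxb⟩ le_rfl
        (H.strictMono_jumpTime (Nat.lt_succ_self n)), he, h0, h0']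
      congr 1
      refine if_congr Iff.rfl ?_ rfl
      have hτ := H.sojourn_pos n
      have hJ := H.jump_pos n
      rw [ih (n + 1) (by positivity)]
      · congr 1
        simp only [pathAfter, add_right_comm n 1, add_assoc]
      · rw [show n + 1 + k = n + (k + 1) by ring, jumpTime_succ]
        have : (b - (x + v * τ n ω + J n ω)) / v ≤ (b - x) / v - τ n ω := by
          rw [div_sub' hv.ne', div_le_div_iff_of_pos_right hv]
          linarith
        linarith
    · rw [if_neg hxb]
      exact H.exitTime_of_le hv (H.jumpTime_nonneg n) hx (not_lt.1 hxb)

/-- Since jump times diverge, the approximations are eventually constant and the limsup is their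
common value; the clipping is inactive because the exit time lies in `[0, b / v]`. -/
lemma exitTimeAfterJump_eq_pathExit {v b : ℝ} (hv : 0 < v) (n : ℕ) {x : ℝ} (hx : 0 < x) :
    exitTimeAfterJump v b τ J n x ω = pathExit v b (pathAfter τ J n ω) x := by
  rcases le_or_gt b x with hb | hb
  · rw [pathExit_of_le _ hb]
    exact H.exitTime_of_le hv (H.jumpTime_nonneg n) hx hb
  · have hlim : Filter.Tendsto (fun k => exitApprox v b k (pathAfter τ J n ω) x) Filter.atTop
        (nhds (exitTimeAfterJump v b τ J n x ω)) := by
      refine tendsto_const_nhds.congr' ?_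
      have h := (H.tendsto_jumpTime.comp (Filter.tendsto_add_atTop_nat n)).eventually_ge_atTop
        ((b - x) / v + jumpTime τ n ω)
      filter_upwards [h] with k hk
      refine H.exitTimeAfterJump_eq_exitApprox hv k n hx ?_
      rw [add_comm n k]
      simp only [Function.comp] at hk
      linarith
    rw [pathExit, if_pos ⟨hx, hb⟩, hlim.limsup_eq, min_eq_right, exitTimeAfterJump,
      max_eq_right exitTime_nonneg]
    refine (H.exitTime_le hv (H.jumpTime_nonneg n) hx).trans
      (max_le (div_nonneg (hx.trans hb).le hv.le) ?_)
    gcongr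
    linarith

end Admissible

/-! ### Laws on the line with a density -/

section Density

variable {ν : Measure ℝ} {f : ℝ → ℝ}

/-- An absolutely continuous probability law on the line has the derivative of its distribution
function as a density. -/
lemma eq_withDensity_deriv_measureReal_Iic [IsProbabilityMeasure ν] (hν : ν ≪ volume) :
    ν = volume.withDensity fun l => ENNReal.ofReal (deriv (fun t => ν.real (Set.Iic t)) l) := by
  have hcdf : (fun t => ν.real (Set.Iic t)) = ProbabilityTheory.cdf ν := by
    ext t
    rw [ProbabilityTheory.cdf_eq_real]
  -- Lebesgue differentiation: the derivative of the distribution function is almost everywhere the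
  -- Radon–Nikodym density.
  have h := (ProbabilityTheory.cdf ν).ae_hasDerivAt
  rw [ProbabilityTheory.measure_cdf] at h
  rw [hcdf]
  conv_lhs => rw [← Measure.withDensity_rnDeriv_eq _ _ hν]
  refine withDensity_congr_ae ?_
  filter_upwards [h, ν.rnDeriv_lt_top volume] with l hl hl'
  rw [hl.deriv, ENNReal.ofReal_toReal hl'.ne]

lemma deriv_measureReal_Iic_nonneg [IsFiniteMeasure ν] (l : ℝ) :
    0 ≤ deriv (fun t => ν.real (Set.Iic t)) l :=
  Monotone.deriv_nonneg fun _ _ hst => measureReal_mono (Set.Iic_subset_Iic.2 hst)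

variable (hν : ν = volume.withDensity fun t => ENNReal.ofReal (f t)) (hf : Measurable f)
  (hf0 : ∀ t, 0 ≤ f t)
include hν hf hf0

lemma setIntegral_of_density (g : ℝ → ℝ) {s : Set ℝ} (hs : MeasurableSet s) :
    ∫ t in s, g t ∂ν = ∫ t in s, f t * g t := by
  rw [hν, setIntegral_withDensity_eq_setIntegral_toReal_smul (by fun_prop)
    (by simp) _ hs]
  simp [ENNReal.toReal_ofReal (hf0 _)]

lemma integrable_density [IsFiniteMeasure ν] : Integrable f := by
  refine ⟨hf.aestronglyMeasurable, ?_⟩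
  rw [hasFiniteIntegral_iff_ofReal (Filter.Eventually.of_forall hf0)]
  have := measure_lt_top ν Set.univ
  rwa [hν, withDensity_apply _ MeasurableSet.univ, Measure.restrict_univ] at this

lemma measureReal_Iic_of_density (hpos : ∀ᵐ t ∂ν, 0 < t) {l : ℝ} (hl : 0 ≤ l) :
    ν.real (Set.Iic l) = ∫ t in (0 : ℝ)..l, f t := by
  have h1 : ν.real (Set.Iic l) = ν.real (Set.Ioc 0 l) := by
    refine measureReal_congr ?_
    filter_upwards [hpos] with t ht
    exact propext ⟨fun h => ⟨ht, h⟩, fun h => h.2⟩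
  have h2 := setIntegral_of_density hν hf hf0 (fun _ => 1) (measurableSet_Ioc (a := 0) (b := l))
  simp only [setIntegral_const, smul_eq_mul, mul_one] at h2
  rw [h1, h2, intervalIntegral.integral_of_le hl]

end Density

/-- Layer cake: the tail of `min e ρ` at `t` is the tail of `e` for `t < ρ` and zero from `ρ` on. -/
lemma integral_min_eq {ν : Measure ℝ} [IsProbabilityMeasure ν] (hpos : ∀ᵐ t ∂ν, 0 < t) {ρ : ℝ}
    (hρ : 0 ≤ ρ) :
    ∫ e, min e ρ ∂ν = ∫ l in (0 : ℝ)..ρ, (1 - ν.real (Set.Iic l)) := by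
  have hint : Integrable (fun e => min e ρ) ν := by
    refine Integrable.of_bound (C := ρ) (by fun_prop) ?_
    filter_upwards [hpos] with e he
    rw [Real.norm_of_nonneg (le_min he.le hρ)]
    exact min_le_right _ _
  rw [hint.integral_eq_integral_meas_lt
    (by filter_upwards [hpos] with e he using le_min he.le hρ),
    intervalIntegral.integral_of_le hρ, integral_Ioc_eq_integral_Ioo,
    setIntegral_eq_of_subset_of_forall_sdiff_eq_zero measurableSet_Ioi
      (fun t (ht : t ∈ Set.Ioo 0 ρ) => ht.1)]
  · refine setIntegral_congr_fun measurableSet_Ioo fun t ht => ?_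
    have : {a : ℝ | t < min a ρ} = (Set.Iic t)ᶜ := by
      ext a
      simp [ht.2]
    simp only [this]
    rw [probReal_compl_eq_one_sub measurableSet_Iic]
  · intro t ht
    have : {a : ℝ | t < min a ρ} = ∅ := by
      ext a
      have h1 : 0 < t := ht.1
      have h2 : ρ ≤ t := not_lt.1 fun h => ht.2 ⟨h1, h⟩
      simp [h2]
    simp only [this, measureReal_empty]

/-! ### Integrating the first-jump decomposition -/

section Renewal

variable {𝒵 : Type*} [MeasurableSpace 𝒵] {μ : Measure 𝒵} [IsProbabilityMeasure μ]
  {ν η : Measure ℝ} [IsProbabilityMeasure ν] [IsProbabilityMeasure η] {f h : ℝ → ℝ}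
  {F : 𝒵 → ℝ → ℝ} {b C : ℝ}

lemma measurable_mean (hF : Measurable (Function.uncurry F)) :
    Measurable fun y => ∫ p, F p y ∂μ :=
  (hF.stronglyMeasurable.integral_prod_left (μ := μ)).measurable

lemma norm_mean_le (hF0 : ∀ p y, 0 ≤ F p y) (hFC : ∀ p y, F p y ≤ C) (y : ℝ) :
    ‖∫ p, F p y ∂μ‖ ≤ C := by
  have := norm_integral_le_of_norm_le_const (μ := μ) (f := fun p => F p y) (C := C)
    (Filter.Eventually.of_forall fun p => by
      rw [Real.norm_of_nonneg (hF0 p y)]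
      exact hFC p y)
  simpa using this

/-- A bounded measurable function is integrable against an integrable density. -/
lemma intervalIntegrable_density_mul {k g : ℝ → ℝ} (hk : Integrable k) (hg : Measurable g)
    (hC : ∀ u, ‖g u‖ ≤ C) (s t : ℝ) :
    IntervalIntegrable (fun u => k u * g u) volume s t :=
  (hk.mul_bdd hg.aestronglyMeasurable (Filter.Eventually.of_forall hC)).intervalIntegrable

variable (hη : η = volume.withDensity fun t => ENNReal.ofReal (h t)) (hh : Measurable h)
  (hh0 : ∀ t, 0 ≤ h t) (hηpos : ∀ᵐ t ∂η, 0 < t)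
include hη hh hh0 hηpos

-- A jump larger than the distance `z` to the barrier lands at or above `b`, where `G` vanishes;
-- this truncates the jump integral at `z`.
omit [IsProbabilityMeasure η] in
lemma integral_eq_of_vanish {G : ℝ → ℝ} (hG : ∀ y, b ≤ y → G y = 0) {z : ℝ} (hz : 0 ≤ z) :
    ∫ u, G (b - z + u) ∂η = ∫ u in (0 : ℝ)..z, h u * G (b - z + u) := by
  rw [intervalIntegral.integral_of_le hz, ← setIntegral_of_density hη hh hh0 _ measurableSet_Ioc,
    setIntegral_eq_integral_of_ae_compl_eq_zero]
  filter_upwards [hηpos] with u hu hu'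
  refine hG _ ?_
  have : z < u := not_le.1 fun hle => hu' ⟨hu, hle⟩
  linarith

variable (hν : ν = volume.withDensity fun t => ENNReal.ofReal (f t)) (hf : Measurable f)
  (hf0 : ∀ t, 0 ≤ f t) (hνpos : ∀ᵐ t ∂ν, 0 < t)
include hν hf hf0

lemma intervalIntegrable_quadrature {G : ℝ → ℝ} (hGm : Measurable G) (hGC : ∀ y, ‖G y‖ ≤ C)
    (hG : ∀ y, b ≤ y → G y = 0) {v x : ℝ} (hv : 0 < v) (hx : x ∈ Set.Ioo 0 b) :
    IntervalIntegrable (fun z => f ((b - x) / v - z / v) *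
      ∫ u in (0 : ℝ)..z, h u * G (b - z + u)) volume 0 (b - x) := by
  have hm : Measurable fun z => ∫ u, G (b - z + u) ∂η := by
    have : Measurable (Function.uncurry fun z u => G (b - z + u)) :=
      hGm.comp (by fun_prop)
    exact (this.stronglyMeasurable.integral_prod_right (ν := η)).measurable
  have hC' : ∀ z, ‖∫ u, G (b - z + u) ∂η‖ ≤ C := fun z => by
    have := norm_integral_le_of_norm_le_const (μ := η) (f := fun u => G (b - z + u)) (C := C)
      (Filter.Eventually.of_forall fun u => hGC _)
    simpa using this
  have hfi : Integrable fun z => f ((b - x) / v - z / v) :=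
    ((integrable_density hν hf hf0).comp_sub_left _).comp_div hv.ne'
  refine (intervalIntegrable_density_mul hfi hm hC' 0 (b - x)).congr fun z hz => ?_
  have hz0 : 0 ≤ z := by
    rw [Set.uIoc_of_le (by linarith [hx.2])] at hz
    exact hz.1.le
  rw [integral_eq_of_vanish hη hh hh0 hηpos hG hz0]

include hνpos

-- Change of variables `z = b - x - v e`, the distance to `b` just before the jump; the factor `1 /
-- v` is the Jacobian.
omit [IsProbabilityMeasure ν] [IsProbabilityMeasure η] in
lemma integral_crossing_eq {G : ℝ → ℝ} (hG : ∀ y, b ≤ y → G y = 0) {v x : ℝ} (hv : 0 < v)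
    (hx : x ∈ Set.Ioo 0 b) :
    ∫ e, (if e < (b - x) / v then ∫ u, G (x + v * e + u) ∂η else 0) ∂ν =
      1 / v * ∫ z in (0 : ℝ)..(b - x), f ((b - x) / v - z / v) *
        ∫ u in (0 : ℝ)..z, h u * G (b - z + u) := by
  have hρ : 0 ≤ (b - x) / v := div_nonneg (by linarith [hx.2]) hv.le
  set Q : ℝ → ℝ := fun e => f e * ∫ u in (0 : ℝ)..(b - x - v * e),
    h u * G (b - (b - x - v * e) + u) with hQ
  have hsub := intervalIntegral.integral_comp_sub_div (a := 0) (b := b - x) Q hv.ne' ((b - x) / v)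
  have hQ' : ∀ z, Q ((b - x) / v - z / v) =
      f ((b - x) / v - z / v) * ∫ u in (0 : ℝ)..z, h u * G (b - z + u) := by
    intro z
    have : b - x - v * ((b - x) / v - z / v) = z := by field_simp; ring
    simp only [hQ, this]
  simp only [hQ', sub_self, zero_div, sub_zero, smul_eq_mul] at hsub
  rw [hsub, ← mul_assoc, one_div, inv_mul_cancel₀ hv.ne', one_mul,
    intervalIntegral.integral_of_le hρ, integral_Ioc_eq_integral_Ioo,
    ← setIntegral_of_density hν hf hf0 _ measurableSet_Ioo,
    ← setIntegral_eq_integral_of_ae_compl_eq_zero (s := Set.Ioo 0 ((b - x) / v))]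
  · refine setIntegral_congr_fun measurableSet_Ioo fun e he => ?_
    have hz : 0 ≤ b - x - v * e := by
      have := (lt_div_iff₀ hv).1 he.2
      linarith
    simp only [if_pos he.2]
    rw [← integral_eq_of_vanish hη hh hh0 hηpos hG hz]
    congr 1
    ext u
    congr 1
    ring
  · filter_upwards [hνpos] with e he he'
    exact if_neg fun hlt => he' ⟨he, hlt⟩

/-- The mean of an exit time that decomposes at the first jump. -/
lemma integral_decomp_eq {Ω : Type*} [MeasurableSpace Ω] {P : Measure Ω}
    {E U : Ω → ℝ} {Z : Ω → 𝒵} (hm : AEMeasurable (fun ω => (E ω, U ω, Z ω)) P)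
    (hlaw : P.map (fun ω => (E ω, U ω, Z ω)) = ν.prod (η.prod μ))
    (hF : Measurable (Function.uncurry F)) (hF0 : ∀ p y, 0 ≤ F p y) (hFC : ∀ p y, F p y ≤ C)
    (hFb : ∀ p y, b ≤ y → F p y = 0) {v x : ℝ} (hv : 0 < v) (hx : x ∈ Set.Ioo 0 b) :
    Integrable (fun ω => min (E ω) ((b - x) / v) +
      if E ω < (b - x) / v then F (Z ω) (x + v * E ω + U ω) else 0) P ∧
    ∫ ω, (min (E ω) ((b - x) / v) +
      if E ω < (b - x) / v then F (Z ω) (x + v * E ω + U ω) else 0) ∂P =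
      (∫ l in (0 : ℝ)..((b - x) / v), (1 - ν.real (Set.Iic l))) +
        1 / v * ∫ z in (0 : ℝ)..(b - x), f ((b - x) / v - z / v) *
          ∫ u in (0 : ℝ)..z, h u * ∫ p, F p (b - z + u) ∂μ := by
  have hρ : 0 ≤ (b - x) / v := div_nonneg (by linarith [hx.2]) hv.le
  have hpos3 : ∀ᵐ q ∂ν.prod (η.prod μ), 0 < q.1 :=
    Measure.quasiMeasurePreserving_fst.ae hνpos
  set R : ℝ × ℝ × 𝒵 → ℝ := fun q =>
    if q.1 < (b - x) / v then F q.2.2 (x + v * q.1 + q.2.1) else 0 with hR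
  have hRm : Measurable R :=
    Measurable.ite (measurableSet_lt measurable_fst measurable_const)
      (hF.comp (f := fun q : ℝ × ℝ × 𝒵 => (q.2.2, x + v * q.1 + q.2.1)) (by fun_prop))
      measurable_const
  have hRi : Integrable R (ν.prod (η.prod μ)) := by
    refine Integrable.of_bound (C := C) hRm.aestronglyMeasurable
      (Filter.Eventually.of_forall fun q => ?_)
    simp only [hR]
    split_ifs
    · rw [Real.norm_of_nonneg (hF0 _ _)]
      exact hFC _ _
    · rw [norm_zero]
      exact (hF0 q.2.2 0).trans (hFC _ _)
  have hMi : Integrable (fun q : ℝ × ℝ × 𝒵 => min q.1 ((b - x) / v)) (ν.prod (η.prod μ)) := by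
    refine Integrable.of_bound (C := (b - x) / v) (by fun_prop) ?_
    filter_upwards [hpos3] with q hq
    rw [Real.norm_of_nonneg (le_min hq.le hρ)]
    exact min_le_right _ _
  have hsum := hMi.add hRi
  rw [← hlaw] at hsum
  refine ⟨hsum.comp_aemeasurable hm, ?_⟩
  have h1 := integral_map hm hsum.aestronglyMeasurable
  simp only [Pi.add_apply, hR] at h1
  rw [← h1, hlaw]
  rw [integral_add hMi hRi]
  congr 1
  · rw [← integral_min_eq hνpos hρ]
    rw [integral_fun_fst (μ := ν) (ν := η.prod μ) (fun e => min e ((b - x) / v))]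
    simp
  · rw [← integral_crossing_eq (G := fun y => ∫ p, F p y ∂μ) hη hh hh0 hηpos hν hf hf0 hνpos
      (fun y hy => by simp [hFb _ _ hy]) hv hx]
    rw [integral_prod _ hRi]
    refine integral_congr_ae (Filter.Eventually.of_forall fun e => ?_)
    simp only [hR]
    split_ifs
    · rw [integral_prod]
      refine Integrable.of_bound (C := C) ?_ (Filter.Eventually.of_forall fun q => ?_)
      · exact (hF.comp (f := fun q : ℝ × 𝒵 => (q.2, x + v * e + q.1))
          (by fun_prop)).aestronglyMeasurable
      · rw [Real.norm_of_nonneg (hF0 _ _)]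
        exact hFC _ _
    · simp

end Renewal

/-! ### Independence of subfamilies -/

section Independence

open ProbabilityTheory

variable {Ω : Type*} [MeasurableSpace Ω] {P : Measure Ω}

/-- Subfamilies of an independent family over disjoint index ranges are independent. -/
lemma indepFun_of_disjoint_range {ι α β : Type*} {X : ι → Ω → ℝ} (hX : ∀ i, Measurable (X i))
    (h : iIndepFun X P) (g : α → ι) (g' : β → ι) (hd : ∀ a b, g a ≠ g' b) :
    IndepFun (fun ω a => X (g a) ω) (fun ω c => X (g' c) ω) P := by
  have hind := indep_iSup_of_disjoint (fun i => (hX i).comap_le) h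
    (S := Set.range g) (T := Set.range g') (by
      rw [Set.disjoint_left]
      rintro _ ⟨a, rfl⟩ ⟨c, hc⟩
      exact hd a c hc.symm)
  rw [IndepFun_iff_Indep, MeasurableSpace.comap_process_pi, MeasurableSpace.comap_process_pi]
  simpa only [iSup_range] using hind

/-- The law of a subfamily of an independent family depends only on its marginals. -/
lemma map_reindex_eq {ι κ : Type*} [Countable κ] {X : ι → Ω → ℝ} (hX : ∀ i, Measurable (X i))
    (h : iIndepFun X P) {g g' : κ → ι} (hg : g.Injective) (hg' : g'.Injective)
    (hlaw : ∀ k, P.map (X (g k)) = P.map (X (g' k))) :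
    P.map (fun ω k => X (g k) ω) = P.map (fun ω k => X (g' k) ω) := by
  rw [(h.precomp hg).map_fun_eq_infinitePi_map fun k => hX _,
    (h.precomp hg').map_fun_eq_infinitePi_map fun k => hX _]
  simp only [hlaw]

/-- On an event determined by `p`, a function of `p` and a variable independent of `p` have a
product law. -/
lemma map_restrict_prod_of_indepFun [IsFiniteMeasure P] {α β γ : Type*} [MeasurableSpace α]
    [MeasurableSpace β] [MeasurableSpace γ] {p : Ω → α} {w : Ω → β} (hp : Measurable p)
    (hw : Measurable w) (hpw : IndepFun p w P) {S : Set α} (hS : MeasurableSet S) {ε : α → γ}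
    (hε : Measurable ε) :
    (P.restrict (p ⁻¹' S)).map (fun ω => (ε (p ω), w ω)) =
      ((P.restrict (p ⁻¹' S)).map fun ω => ε (p ω)).prod (P.map w) := by
  refine (Measure.prod_eq fun A B hA hB => ?_).symm
  have hεp : Measurable fun ω => ε (p ω) := hε.comp hp
  rw [Measure.map_apply (hεp.prodMk hw) (hA.prod hB), Measure.map_apply hεp hA,
    Measure.map_apply hw hB, Measure.restrict_apply (hεp.prodMk hw (hA.prod hB)),
    Measure.restrict_apply (hεp hA)]
  have h := hpw.measure_inter_preimage_eq_mul (ε ⁻¹' A ∩ S) B ((hε hA).inter hS) hB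
  rw [Set.preimage_inter] at h
  refine Eq.trans ?_ h
  congr 1
  ext ω
  simp only [Set.mem_inter_iff, Set.mem_preimage, Set.mem_prod]
  tauto

end Independence

/-! ### Laws of the restarted path and divergence of the jump times -/

section Walk

open ProbabilityTheory

variable {Ω : Type*} [MeasurableSpace Ω] {P : Measure Ω} {τ J : ℕ → Ω → ℝ}

lemma measurable_jumpTime (hτ : ∀ n, Measurable (τ n)) (n : ℕ) : Measurable (jumpTime τ n) := by
  unfold jumpTime
  fun_prop

lemma measurable_pathAfter (hτ : ∀ n, Measurable (τ n)) (hJ : ∀ n, Measurable (J n)) (n : ℕ) :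
    Measurable (pathAfter τ J n) := by
  unfold pathAfter
  fun_prop

lemma measurable_sumElim (hτ : ∀ n, Measurable (τ n)) (hJ : ∀ n, Measurable (J n)) (i : ℕ ⊕ ℕ) :
    Measurable ((Sum.elim τ J : ℕ ⊕ ℕ → Ω → ℝ) i) := by
  cases i
  exacts [hτ _, hJ _]

/-- The index of a sojourn time or jump of the walk restarted after the `n`-th jump. -/
def shiftIndex (n : ℕ) : ℕ ⊕ ℕ → ℕ ⊕ ℕ := Sum.map (n + ·) (n + ·)

lemma shiftIndex_injective (n : ℕ) : (shiftIndex n).Injective :=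
  (add_right_injective n).sumMap (add_right_injective n)

omit [MeasurableSpace Ω] in
/-- The path after the `n`-th jump as a function of the restarted family. -/
lemma pathAfter_eq (n : ℕ) : pathAfter τ J n =
    (fun y : ℕ ⊕ ℕ → ℝ => (fun i => y (Sum.inl i), fun i => y (Sum.inr i))) ∘
      fun ω k => (Sum.elim τ J : ℕ ⊕ ℕ → Ω → ℝ) (shiftIndex n k) ω := rfl

variable (hτ : ∀ n, Measurable (τ n)) (hJ : ∀ n, Measurable (J n))
  (hind : iIndepFun (Sum.elim τ J : ℕ ⊕ ℕ → Ω → ℝ) P)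
include hτ hJ hind

lemma map_pathAfter (hτlaw : ∀ m n, P.map (τ m) = P.map (τ n))
    (hJlaw : ∀ m n, P.map (J m) = P.map (J n)) (n : ℕ) :
    P.map (pathAfter τ J n) = P.map (pathAfter τ J 0) := by
  have hX := measurable_sumElim hτ hJ
  have h := map_reindex_eq hX hind (shiftIndex_injective n) (shiftIndex_injective 0) (by
    rintro (k | k)
    exacts [hτlaw _ _, hJlaw _ _])
  rw [pathAfter_eq, pathAfter_eq, ← Measure.map_map (by fun_prop) (by fun_prop), h,
    Measure.map_map (by fun_prop) (by fun_prop)]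

lemma indepFun_jump_pathAfter (n : ℕ) : IndepFun (J n) (pathAfter τ J (n + 1)) P := by
  have h := indepFun_of_disjoint_range (measurable_sumElim hτ hJ) hind
    (fun _ : Unit => Sum.inr n) (shiftIndex (n + 1)) (by
      rintro _ (k | k)
      · simp [shiftIndex]
      · simp only [shiftIndex, Sum.map_inr, ne_eq, Sum.inr.injEq]
        omega)
  rw [pathAfter_eq]
  exact h.comp (φ := fun y : Unit → ℝ => y ())
    (ψ := fun y : ℕ ⊕ ℕ → ℝ => (fun i => y (Sum.inl i), fun i => y (Sum.inr i)))
    (by fun_prop) (by fun_prop)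

/-- The two sides depend on disjoint sets of indices. The pair on the left is what decides whether
exactly `n` jumps have occurred by a given time. -/
lemma indepFun_jumpTime_pathAfter (n : ℕ) :
    IndepFun (fun ω => (jumpTime τ n ω, τ n ω)) (fun ω => (J n ω, pathAfter τ J (n + 1) ω)) P := by
  have h := indepFun_of_disjoint_range (measurable_sumElim hτ hJ) hind
    (fun i : Fin (n + 1) => Sum.inl (i : ℕ))
    (Sum.elim (fun _ : Unit => Sum.inr n) (shiftIndex (n + 1))) (by
      rintro ⟨i, hi⟩ (_ | k | k)
      · simp
      · simp only [shiftIndex, Sum.elim_inr, Sum.map_inl, ne_eq, Sum.inl.injEq]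
        omega
      · simp [shiftIndex])
  have h2 := h.comp
    (φ := fun y : Fin (n + 1) → ℝ => (∑ i : Fin n, y i.castSucc, y (Fin.last n)))
    (ψ := fun y : Unit ⊕ ℕ ⊕ ℕ → ℝ => (y (Sum.inl ()),
      ((fun i => y (Sum.inr (Sum.inl i)), fun i => y (Sum.inr (Sum.inr i))) :
        (ℕ → ℝ) × (ℕ → ℝ)))) (by fun_prop) (by fun_prop)
  convert h2 using 1
  · ext ω : 1
    simp [jumpTime, Finset.sum_range]
  · rfl

lemma indepFun_jumpTime_sojourn (n : ℕ) : IndepFun (jumpTime τ n) (τ n) P := by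
  have h := indepFun_of_disjoint_range (measurable_sumElim hτ hJ) hind
    (fun i : Fin n => Sum.inl (i : ℕ)) (fun _ : Unit => Sum.inl n) (by
      rintro ⟨i, hi⟩ _
      simpa using hi.ne)
  have hu : Measurable fun y : Unit → ℝ => y () := measurable_pi_apply ()
  have h2 := h.comp (φ := fun y : Fin n → ℝ => ∑ i : Fin n, y i) (ψ := fun y : Unit → ℝ => y ())
    (by fun_prop) hu
  convert h2 using 1
  · ext ω
    simp [jumpTime, Finset.sum_range]
  · rfl

-- Sojourn times need not have a finite mean, so Laplace transforms are used: `E exp(-t_n) = c ^ n`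
-- with `c < 1`, hence `∑ exp(-t_n)` has finite mean and `exp(-t_n) → 0` almost surely.
omit hJ in
lemma ae_tendsto_jumpTime [IsProbabilityMeasure P] (hτlaw : ∀ n, P.map (τ n) = P.map (τ 0))
    (hpos : ∀ n, ∀ᵐ ω ∂P, 0 < τ n ω) :
    ∀ᵐ ω ∂P, Filter.Tendsto (fun n => jumpTime τ n ω) Filter.atTop Filter.atTop := by
  have hindτ : iIndepFun τ P := hind.precomp (g := Sum.inl) Sum.inl_injective
  have hposall : ∀ᵐ ω ∂P, ∀ n, 0 < τ n ω := ae_all_iff.2 hpos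
  set c := mgf (τ 0) P (-1) with hc
  have hmgf : ∀ n, mgf (jumpTime τ n) P (-1) = c ^ n := by
    intro n
    have h1 : jumpTime τ n = ∑ i ∈ Finset.range n, τ i := by
      ext ω; simp [jumpTime]
    rw [h1, hindτ.mgf_sum hτ]
    rw [Finset.prod_congr rfl (g := fun _ => c)]
    · simp
    · intro i _
      rw [hc, ← mgf_id_map (hτ i).aemeasurable, ← mgf_id_map (hτ 0).aemeasurable, hτlaw]
  have hint : ∀ n, Integrable (fun ω => Real.exp (-1 * jumpTime τ n ω)) P := by
    intro n
    have := measurable_jumpTime hτ n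
    refine Integrable.of_bound (C := 1) (by fun_prop) ?_
    filter_upwards [hposall] with ω hω
    rw [Real.norm_of_nonneg (Real.exp_pos _).le, Real.exp_le_one_iff]
    have : 0 ≤ jumpTime τ n ω := Finset.sum_nonneg fun i _ => (hω i).le
    linarith
  have hc0 : 0 ≤ c := mgf_nonneg
  have hc1 : c < 1 := by
    have h1 : Integrable (fun ω => Real.exp (-1 * τ 0 ω)) P := by
      simpa [jumpTime] using hint 1
    have hsub : 0 < ∫ ω, (1 - Real.exp (-1 * τ 0 ω)) ∂P := by
      have hae : ∀ᵐ ω ∂P, 0 < 1 - Real.exp (-1 * τ 0 ω) := by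
        filter_upwards [hpos 0] with ω hω
        rw [sub_pos, Real.exp_lt_one_iff]
        linarith
      rw [integral_pos_iff_support_of_nonneg_ae (hae.mono fun _ h => h.le)
        ((integrable_const 1).sub h1)]
      have : P (Function.support fun ω => 1 - Real.exp (-1 * τ 0 ω)) = P Set.univ := by
        refine measure_congr ?_
        filter_upwards [hae] with ω hω
        exact propext ⟨fun _ => trivial, fun _ => hω.ne'⟩
      rw [this]
      simp
    rw [integral_sub (integrable_const 1) h1] at hsub
    simp only [integral_const, probReal_univ, smul_eq_mul, mul_one, sub_pos] at hsub
    exact hsub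
  have hfin : ∫⁻ ω, ∑' n, ENNReal.ofReal (Real.exp (-1 * jumpTime τ n ω)) ∂P ≠ ⊤ := by
    have hmeas := measurable_jumpTime hτ
    rw [lintegral_tsum fun n => by fun_prop]
    have : ∀ n, ∫⁻ ω, ENNReal.ofReal (Real.exp (-1 * jumpTime τ n ω)) ∂P =
        ENNReal.ofReal (c ^ n) := by
      intro n
      rw [← ofReal_integral_eq_lintegral_ofReal (hint n)
        (Filter.Eventually.of_forall fun _ => (Real.exp_pos _).le), ← hmgf n]
      rfl
    simp_rw [this]
    exact (summable_geometric_of_lt_one hc0 hc1).tsum_ofReal_ne_top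
  have hmeas := measurable_jumpTime hτ
  filter_upwards [ae_lt_top (by fun_prop) hfin] with ω hω
  have h0 := ENNReal.tendsto_atTop_zero_of_tsum_ne_top hω.ne
  have h1 : Filter.Tendsto (fun n => Real.exp (-1 * jumpTime τ n ω)) Filter.atTop (nhds 0) := by
    have := (ENNReal.tendsto_toReal ENNReal.zero_ne_top).comp h0
    simpa [Function.comp_def, ENNReal.toReal_ofReal (Real.exp_pos _).le] using this
  rw [Real.tendsto_exp_comp_nhds_zero] at h1
  simpa using Filter.tendsto_neg_atBot_iff.1 (by simpa using h1)

omit hJ in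
lemma ae_admissible [IsProbabilityMeasure P] (hτlaw : ∀ n, P.map (τ n) = P.map (τ 0))
    (hpos : ∀ n, ∀ᵐ ω ∂P, 0 < τ n ω) (hJpos : ∀ n, ∀ᵐ ω ∂P, 0 < J n ω) :
    ∀ᵐ ω ∂P, Admissible τ J ω := by
  filter_upwards [ae_all_iff.2 hpos, ae_all_iff.2 hJpos,
    ae_tendsto_jumpTime hτ hind hτlaw hpos] with ω h1 h2 h3
  exact ⟨h1, h2, h3⟩

lemma map_jump_pathAfter [IsProbabilityMeasure P] (hτlaw : ∀ m n, P.map (τ m) = P.map (τ n))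
    (hJlaw : ∀ m n, P.map (J m) = P.map (J n)) (n : ℕ) :
    P.map (fun ω => (J n ω, pathAfter τ J (n + 1) ω)) =
      (P.map (J 0)).prod (P.map (pathAfter τ J 0)) := by
  rw [(indepFun_iff_map_prod_eq_prod_map_map (hJ n).aemeasurable
    (measurable_pathAfter hτ hJ (n + 1)).aemeasurable).1 (indepFun_jump_pathAfter hτ hJ hind n),
    map_pathAfter hτ hJ hind hτlaw hJlaw, hJlaw n 0]

/-- The law of the `n`-th sojourn time, the jump that ends it, and the subsequent path. -/
lemma map_sojourn_jump_pathAfter [IsProbabilityMeasure P]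
    (hτlaw : ∀ m n, P.map (τ m) = P.map (τ n)) (hJlaw : ∀ m n, P.map (J m) = P.map (J n))
    (n : ℕ) :
    P.map (fun ω => (τ n ω, J n ω, pathAfter τ J (n + 1) ω)) =
      (P.map (τ n)).prod ((P.map (J 0)).prod (P.map (pathAfter τ J 0))) := by
  rw [← map_jump_pathAfter hτ hJ hind hτlaw hJlaw n]
  have := measurable_pathAfter hτ hJ (n + 1)
  exact (indepFun_iff_map_prod_eq_prod_map_map (hτ n).aemeasurable (by fun_prop)).1
    ((indepFun_jumpTime_pathAfter hτ hJ hind n).comp measurable_snd measurable_id)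

end Walk

/-! ### The excess life and its independence of the future -/

section Excess

open ProbabilityTheory

variable {Ω : Type*} [MeasurableSpace Ω] {P : Measure Ω} {τ J : ℕ → Ω → ℝ}

/-- The event that exactly `n` jumps have occurred by time `r`. -/
def countEvent (τ : ℕ → Ω → ℝ) (r : ℝ) (n : ℕ) : Set Ω :=
  (fun ω => (jumpTime τ n ω, τ n ω)) ⁻¹' {q | q.1 ≤ r ∧ r < q.1 + q.2}

omit [MeasurableSpace Ω] in
lemma mem_countEvent {r : ℝ} {n : ℕ} {ω : Ω} :
    ω ∈ countEvent τ r n ↔ jumpTime τ n ω ≤ r ∧ r < jumpTime τ (n + 1) ω := by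
  rw [jumpTime_succ]
  rfl

lemma measurableSet_between (r : ℝ) : MeasurableSet {q : ℝ × ℝ | q.1 ≤ r ∧ r < q.1 + q.2} :=
  (measurableSet_le measurable_fst measurable_const).inter
    (measurableSet_lt measurable_const (measurable_fst.add measurable_snd))

lemma measurableSet_countEvent (hτ : ∀ n, Measurable (τ n)) (r : ℝ) (n : ℕ) :
    MeasurableSet (countEvent τ r n) :=
  ((measurable_jumpTime hτ n).prodMk (hτ n)) (measurableSet_between r)

/-- The events partition the space only up to a null set: covering and disjointness both come from
admissibility. -/
lemma sum_restrict_countEvent (hτ : ∀ n, Measurable (τ n)) (hadm : ∀ᵐ ω ∂P, Admissible τ J ω)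
    {r : ℝ} (hr : 0 ≤ r) : Measure.sum (fun n => P.restrict (countEvent τ r n)) = P := by
  rw [← Measure.restrict_iUnion_ae]
  · refine Measure.restrict_eq_self_of_ae_mem ?_
    filter_upwards [hadm] with ω H
    obtain ⟨n, hn⟩ := H.exists_between hr
    exact Set.mem_iUnion.2 ⟨n, mem_countEvent.2 hn⟩
  · intro m n hmn
    refine measure_mono_null ?_ (ae_iff.1 hadm)
    rintro ω ⟨hm, hn⟩ H
    rw [mem_countEvent] at hm hn
    exact hmn ((H.jumpCount_eq hm.1 hm.2).symm.trans (H.jumpCount_eq hn.1 hn.2))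
  · exact fun n => (measurableSet_countEvent hτ r n).nullMeasurableSet

/-- The excess life, the jump that ends it, and the subsequent path. -/
noncomputable def excessTriple (τ J : ℕ → Ω → ℝ) (r : ℝ) (ω : Ω) : ℝ × ℝ × (ℕ → ℝ) × (ℕ → ℝ) :=
  (excessLife τ r ω, J (jumpCount τ r ω) ω, pathAfter τ J (jumpCount τ r ω + 1) ω)

lemma excessTriple_ae_eq (hτ : ∀ n, Measurable (τ n)) (hadm : ∀ᵐ ω ∂P, Admissible τ J ω)
    (r : ℝ) (n : ℕ) :
    excessTriple τ J r =ᵐ[P.restrict (countEvent τ r n)]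
      fun ω => (jumpTime τ n ω + τ n ω - r, J n ω, pathAfter τ J (n + 1) ω) := by
  filter_upwards [ae_restrict_of_ae hadm, ae_restrict_mem (measurableSet_countEvent hτ r n)]
    with ω H hω
  rw [mem_countEvent] at hω
  rw [excessTriple, H.excessLife_eq hω.1 hω.2, H.jumpCount_eq hω.1 hω.2, jumpTime_succ]

lemma aemeasurable_excessTriple (hτ : ∀ n, Measurable (τ n)) (hJ : ∀ n, Measurable (J n))
    (hadm : ∀ᵐ ω ∂P, Admissible τ J ω) {r : ℝ} (hr : 0 ≤ r) :
    AEMeasurable (excessTriple τ J r) P := by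
  rw [← sum_restrict_countEvent hτ hadm hr, aemeasurable_sum_measure_iff]
  intro n
  refine AEMeasurable.congr (Measurable.aemeasurable ?_) (excessTriple_ae_eq hτ hadm r n).symm
  have h1 := measurable_jumpTime hτ n
  have h2 := measurable_pathAfter hτ hJ (n + 1)
  fun_prop

lemma aemeasurable_excessLife (hτ : ∀ n, Measurable (τ n)) (hJ : ∀ n, Measurable (J n))
    (hadm : ∀ᵐ ω ∂P, Admissible τ J ω) {r : ℝ} (hr : 0 ≤ r) :
    AEMeasurable (excessLife τ r) P :=
  (aemeasurable_excessTriple hτ hJ hadm hr).fst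

lemma map_excessLife_eq_sum (hτ : ∀ n, Measurable (τ n)) (hJ : ∀ n, Measurable (J n))
    (hadm : ∀ᵐ ω ∂P, Admissible τ J ω) {r : ℝ} (hr : 0 ≤ r) :
    P.map (excessLife τ r) = Measure.sum fun n =>
      (P.restrict (countEvent τ r n)).map fun ω => jumpTime τ n ω + τ n ω - r := by
  have hP := sum_restrict_countEvent hτ hadm hr
  have hE := aemeasurable_excessLife hτ hJ hadm hr
  conv_lhs => rw [← hP]
  rw [Measure.map_sum (by rwa [hP])]
  congr 1
  ext1 n
  refine Measure.map_congr ?_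
  filter_upwards [excessTriple_ae_eq hτ hadm r n] with ω hω
  exact congrArg Prod.fst hω

lemma ae_excessLife_pos (hadm : ∀ᵐ ω ∂P, Admissible τ J ω) {r : ℝ} (hr : 0 ≤ r) :
    ∀ᵐ ω ∂P, 0 < excessLife τ r ω := by
  filter_upwards [hadm] with ω H
  obtain ⟨n, h1, h2⟩ := H.exists_between hr
  rw [H.excessLife_eq h1 h2]
  linarith

variable [IsProbabilityMeasure P] (hτ : ∀ n, Measurable (τ n)) (hJ : ∀ n, Measurable (J n))
  (hind : iIndepFun (Sum.elim τ J : ℕ ⊕ ℕ → Ω → ℝ) P) (hadm : ∀ᵐ ω ∂P, Admissible τ J ω)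
include hτ hJ hind hadm

/-- On the event of exactly `n` jumps by time `r`, the excess is a function of `(t_n, τ_{n+1})`,
independent of the next jump and later path. The law of the latter does not depend on `n`, so the
product laws sum to a product law. -/
lemma map_excessTriple (hτlaw : ∀ m n, P.map (τ m) = P.map (τ n))
    (hJlaw : ∀ m n, P.map (J m) = P.map (J n)) {r : ℝ} (hr : 0 ≤ r) :
    P.map (excessTriple τ J r) =
      (P.map (excessLife τ r)).prod ((P.map (J 0)).prod (P.map (pathAfter τ J 0))) := by
  have hP := sum_restrict_countEvent hτ hadm hr
  have hE := aemeasurable_excessTriple hτ hJ hadm hr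
  rw [map_excessLife_eq_sum hτ hJ hadm hr, Measure.prod_sum_left]
  conv_lhs => rw [← hP]
  rw [Measure.map_sum (by rwa [hP])]
  congr 1
  ext1 n
  rw [Measure.map_congr (excessTriple_ae_eq hτ hadm r n),
    ← map_jump_pathAfter hτ hJ hind hτlaw hJlaw n]
  have h1 := measurable_jumpTime hτ n
  have h2 := measurable_pathAfter hτ hJ (n + 1)
  exact map_restrict_prod_of_indepFun (ε := fun q : ℝ × ℝ => q.1 + q.2 - r) (by fun_prop)
    (by fun_prop) (indepFun_jumpTime_pathAfter hτ hJ hind n) (measurableSet_between r)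
    (by fun_prop)

/-- Each piece is dominated by the law of `(t_n - r) + τ_{n+1}`, a convolution with an absolutely
continuous law. -/
lemma map_excessLife_absolutelyContinuous (hac : ∀ n, P.map (τ n) ≪ volume) {r : ℝ}
    (hr : 0 ≤ r) : P.map (excessLife τ r) ≪ volume := by
  rw [map_excessLife_eq_sum hτ hJ hadm hr]
  refine Measure.absolutelyContinuous_sum_left fun n => ?_
  have h1 := measurable_jumpTime hτ n
  refine (Measure.restrict_le_self.absolutelyContinuous.map (by fun_prop)).trans ?_
  have hi : IndepFun (fun ω => jumpTime τ n ω - r) (τ n) P :=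
    (indepFun_jumpTime_sojourn hτ hJ hind n).comp (φ := fun t => t - r) (by fun_prop)
      measurable_id
  have heq : (fun ω => jumpTime τ n ω + τ n ω - r) =
      (fun ω => jumpTime τ n ω - r) + τ n := by
    ext ω
    simp only [Pi.add_apply]
    ring
  rw [heq, hi.map_add_eq_map_conv_map₀ (by fun_prop) (by fun_prop)]
  have := Measure.isProbabilityMeasure_map (μ := P) (hτ n).aemeasurable
  exact Measure.conv_absolutelyContinuous (hac n)

end Excess

/-! ### Mean exit times as integrals over path space -/

section Means

open ProbabilityTheory

variable {Ω : Type*} [MeasurableSpace Ω] {P : Measure Ω} {τ J : ℕ → Ω → ℝ}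

lemma excessCDF_eq {r : ℝ} (hm : AEMeasurable (excessLife τ r) P) (l : ℝ) :
    excessCDF P τ r l = (P.map (excessLife τ r)).real (Set.Iic l) := by
  rw [map_measureReal_apply_of_aemeasurable hm measurableSet_Iic]
  rfl

lemma meanExitTimeAfterJump_eq (hτ : ∀ n, Measurable (τ n)) (hJ : ∀ n, Measurable (J n))
    (hadm : ∀ᵐ ω ∂P, Admissible τ J ω) {v b : ℝ} (hv : 0 < v) (n : ℕ) {y : ℝ} (hy : 0 < y) :
    meanExitTimeAfterJump P v b τ J n y = ∫ p, pathExit v b p y ∂(P.map (pathAfter τ J n)) := by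
  have hF : Measurable fun p => pathExit v b p y :=
    (measurable_pathExit v b).comp (f := fun p => (p, y)) (by fun_prop)
  rw [integral_map (measurable_pathAfter hτ hJ n).aemeasurable hF.aestronglyMeasurable]
  refine integral_congr_ae ?_
  filter_upwards [hadm] with ω H
  exact H.exitTimeAfterJump_eq_pathExit hv n hy

end Means

end CTRW

theorem mainTheorem1 {Ω : Type*} [MeasurableSpace Ω] (P : Measure Ω) [IsProbabilityMeasure P]
    (τ J : ℕ → Ω → ℝ) (ψ h : ℝ → ℝ) (v b : ℝ) (hv : 0 < v)
    (hτ_meas : ∀ n, Measurable (τ n)) (hJ_meas : ∀ n, Measurable (J n))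
    (hψ_meas : Measurable ψ) (hψ_nonneg : ∀ t, 0 ≤ ψ t)
    (hh_meas : Measurable h) (hh_nonneg : ∀ u, 0 ≤ h u)
    -- each sojourn time has density `ψ`, each jump has density `h`
    (hτ_law : ∀ n, P.map (τ n) = volume.withDensity fun t => ENNReal.ofReal (ψ t))
    (hJ_law : ∀ n, P.map (J n) = volume.withDensity fun u => ENNReal.ofReal (h u))
    (hτ_pos : ∀ n, ∀ᵐ ω ∂P, 0 < τ n ω) (hJ_pos : ∀ n, ∀ᵐ ω ∂P, 0 < J n ω)
    -- all sojourn times and all jumps are mutually independent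
    (h_indep : ProbabilityTheory.iIndepFun (Sum.elim τ J : ℕ ⊕ ℕ → Ω → ℝ) P) :
    -- the mean exit time after a jump: it is finite, does not depend on which jump it is,
    -- and solves the integral equation
    (∀ (n : ℕ), ∀ x ∈ Set.Ioo 0 b,
      Integrable (CTRW.exitTimeAfterJump v b τ J n x) P ∧
      CTRW.meanExitTimeAfterJump P v b τ J n x = CTRW.meanExitTimeAfterJump P v b τ J 0 x ∧
      (∀ z ∈ Set.Icc 0 (b - x), IntervalIntegrable
        (fun u => h u * CTRW.meanExitTimeAfterJump P v b τ J n (b - z + u)) volume 0 z) ∧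
      IntervalIntegrable
        (fun z => ψ ((b - x) / v - z / v) *
          ∫ u in (0 : ℝ)..z, h u * CTRW.meanExitTimeAfterJump P v b τ J n (b - z + u))
        volume 0 (b - x) ∧
      CTRW.meanExitTimeAfterJump P v b τ J n x =
        (∫ l in (0 : ℝ)..((b - x) / v), (1 - CTRW.densityCDF ψ l)) +
        1 / v * ∫ z in (0 : ℝ)..(b - x), ψ ((b - x) / v - z / v) *
          ∫ u in (0 : ℝ)..z, h u * CTRW.meanExitTimeAfterJump P v b τ J n (b - z + u)) ∧
    -- the excess life has density `φ(·|r)`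
    (∀ r : ℝ, 0 ≤ r → ∀ l : ℝ, 0 ≤ l →
      IntervalIntegrable (CTRW.excessPDF P τ r) volume 0 l ∧
      CTRW.excessCDF P τ r l = ∫ s in (0 : ℝ)..l, CTRW.excessPDF P τ r s) ∧
    -- the mean exit time from an arbitrary present time is finite and given by the quadrature
    (∀ r : ℝ, 0 ≤ r → ∀ n : ℕ, ∀ x ∈ Set.Ioo 0 b,
      Integrable (CTRW.exitTime v b τ J r x) P ∧
      IntervalIntegrable (fun l => 1 - CTRW.excessCDF P τ r l) volume 0 ((b - x) / v) ∧
      IntervalIntegrable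
        (fun z => CTRW.excessPDF P τ r ((b - x) / v - z / v) *
          ∫ u in (0 : ℝ)..z, h u * CTRW.meanExitTimeAfterJump P v b τ J n (b - z + u))
        volume 0 (b - x) ∧
      CTRW.meanExitTime P v b τ J x r =
        (∫ l in (0 : ℝ)..((b - x) / v), (1 - CTRW.excessCDF P τ r l)) +
        1 / v * ∫ z in (0 : ℝ)..(b - x), CTRW.excessPDF P τ r ((b - x) / v - z / v) *
          ∫ u in (0 : ℝ)..z, h u * CTRW.meanExitTimeAfterJump P v b τ J n (b - z + u)) := by
  have hτpair : ∀ m n, P.map (τ m) = P.map (τ n) := fun m n => by rw [hτ_law, hτ_law]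
  have hJpair : ∀ m n, P.map (J m) = P.map (J n) := fun m n => by rw [hJ_law, hJ_law]
  have hadm : ∀ᵐ ω ∂P, CTRW.Admissible τ J ω :=
    CTRW.ae_admissible hτ_meas h_indep (fun n => hτpair n 0) hτ_pos hJ_pos
  have hprob : ∀ {β : Type} [MeasurableSpace β] {X : Ω → β}, AEMeasurable X P →
      IsProbabilityMeasure (P.map X) := fun hX => Measure.isProbabilityMeasure_map hX
  have hZ := CTRW.measurable_pathAfter hτ_meas hJ_meas
  have hprobτ := fun n => hprob (hτ_meas n).aemeasurable
  have hprobJ := hprob (hJ_meas 0).aemeasurable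
  have hprobZ := hprob (hZ 0).aemeasurable
  have hτpos' : ∀ n, ∀ᵐ t ∂(P.map (τ n)), 0 < t := fun n =>
    (ae_map_iff (hτ_meas n).aemeasurable measurableSet_Ioi).2 (hτ_pos n)
  have hJpos' : ∀ᵐ t ∂(P.map (J 0)), 0 < t :=
    (ae_map_iff (hJ_meas 0).aemeasurable measurableSet_Ioi).2 (hJ_pos 0)
  have hh_int : Integrable h := CTRW.integrable_density (hJ_law 0) hh_meas hh_nonneg
  -- `M` stands in for the mean exit time after a jump: it does not involve `n`, and it is
  -- measurable and bounded on the whole line, while agreement with the actual mean is needed only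
  -- at positive states.
  set M : ℝ → ℝ := fun y => ∫ p, CTRW.pathExit v b p y ∂(P.map (CTRW.pathAfter τ J 0)) with hM
  have hF : Measurable (Function.uncurry (CTRW.pathExit v b)) := CTRW.measurable_pathExit v b
  have hMm : Measurable M := CTRW.measurable_mean hF
  have hMC : ∀ y, ‖M y‖ ≤ |b| / v :=
    CTRW.norm_mean_le (CTRW.pathExit_nonneg v b) (CTRW.pathExit_le hv b)
  have hMb : ∀ y, b ≤ y → M y = 0 := fun y hy => by
    simp [hM, CTRW.pathExit_of_le _ hy]
  have hmean : ∀ n y, 0 < y → CTRW.meanExitTimeAfterJump P v b τ J n y = M y := by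
    intro n y hy
    rw [CTRW.meanExitTimeAfterJump_eq hτ_meas hJ_meas hadm hv n hy,
      CTRW.map_pathAfter hτ_meas hJ_meas h_indep hτpair hJpair]
  -- On the range of integration `b - z + u ≥ x > 0`, so the mean may be replaced by `M`.
  have hinner : ∀ n, ∀ x ∈ Set.Ioo 0 b, ∀ z ∈ Set.Icc 0 (b - x), Set.EqOn
      (fun u => h u * CTRW.meanExitTimeAfterJump P v b τ J n (b - z + u))
      (fun u => h u * M (b - z + u)) (Set.uIcc 0 z) := by
    intro n x hx z hz u hu
    rw [Set.uIcc_of_le hz.1] at hu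
    have : 0 < b - z + u := by linarith [hx.1, hz.2, hu.1]
    simp only [hmean n _ this]
  have houter : ∀ n, ∀ x ∈ Set.Ioo 0 b, ∀ f : ℝ → ℝ, Set.EqOn
      (fun z => f ((b - x) / v - z / v) *
        ∫ u in (0 : ℝ)..z, h u * CTRW.meanExitTimeAfterJump P v b τ J n (b - z + u))
      (fun z => f ((b - x) / v - z / v) * ∫ u in (0 : ℝ)..z, h u * M (b - z + u))
      (Set.uIcc 0 (b - x)) := by
    intro n x hx f z hz
    rw [Set.uIcc_of_le (by linarith [hx.2])] at hz
    simp only [intervalIntegral.integral_congr (hinner n x hx z hz)]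
  have hexc_m : ∀ r, 0 ≤ r → AEMeasurable (CTRW.excessLife τ r) P := fun r hr =>
    CTRW.aemeasurable_excessLife hτ_meas hJ_meas hadm hr
  have hexc_pos : ∀ r, 0 ≤ r → ∀ᵐ t ∂(P.map (CTRW.excessLife τ r)), 0 < t := fun r hr =>
    (ae_map_iff (hexc_m r hr) measurableSet_Ioi).2 (CTRW.ae_excessLife_pos hadm hr)
  have hexc_pdf : ∀ r, 0 ≤ r → CTRW.excessPDF P τ r =
      fun l => deriv (fun t => (P.map (CTRW.excessLife τ r)).real (Set.Iic t)) l := by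
    intro r hr
    ext l
    simp only [CTRW.excessPDF, CTRW.excessCDF_eq (hexc_m r hr)]
  have hexc_law : ∀ r, 0 ≤ r → P.map (CTRW.excessLife τ r) =
      volume.withDensity fun l => ENNReal.ofReal (CTRW.excessPDF P τ r l) := by
    intro r hr
    have := hprob (hexc_m r hr)
    rw [hexc_pdf r hr]
    refine CTRW.eq_withDensity_deriv_measureReal_Iic ?_
    refine CTRW.map_excessLife_absolutelyContinuous hτ_meas hJ_meas h_indep hadm (fun n => ?_) hr
    rw [hτ_law]
    exact withDensity_absolutelyContinuous _ _
  have hpdf_m : ∀ r, Measurable (CTRW.excessPDF P τ r) := fun r => measurable_deriv _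
  have hpdf_nn : ∀ r, 0 ≤ r → ∀ l, 0 ≤ CTRW.excessPDF P τ r l := by
    intro r hr l
    have := hprob (hexc_m r hr)
    rw [hexc_pdf r hr]
    exact CTRW.deriv_measureReal_Iic_nonneg l
  refine ⟨fun n x hx => ?_, fun r hr l hl => ?_, fun r hr n x hx => ?_⟩
  -- After a jump, the waiting time is a full sojourn, with density `ψ`.
  · have hdec := CTRW.integral_decomp_eq (hJ_law 0) hh_meas hh_nonneg hJpos' (hτ_law n) hψ_meas
      hψ_nonneg (hτpos' n)
      (((hτ_meas n).prodMk ((hJ_meas n).prodMk (hZ (n + 1)))).aemeasurable)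
      (CTRW.map_sojourn_jump_pathAfter hτ_meas hJ_meas h_indep hτpair hJpair n)
      hF (CTRW.pathExit_nonneg v b) (CTRW.pathExit_le hv b)
      (fun p y hy => CTRW.pathExit_of_le p hy) hv hx
    have hae : CTRW.exitTimeAfterJump v b τ J n x =ᵐ[P] fun ω => min (τ n ω) ((b - x) / v) +
        if τ n ω < (b - x) / v then
          CTRW.pathExit v b (CTRW.pathAfter τ J (n + 1) ω) (x + v * τ n ω + J n ω) else 0 := by
      filter_upwards [hadm] with ω H
      have hτ0 := H.sojourn_pos n
      have hJ0 := H.jump_pos n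
      have hx0 := hx.1
      rw [CTRW.exitTimeAfterJump, H.exitTime_decomp hv hx le_rfl
        (H.strictMono_jumpTime (Nat.lt_succ_self n)), CTRW.jumpTime_succ, add_sub_cancel_left,
        H.exitTimeAfterJump_eq_pathExit hv (n + 1) (by positivity)]
    refine ⟨hdec.1.congr hae.symm, ?_, fun z hz => ?_, ?_, ?_⟩
    · rw [hmean n x hx.1, hmean 0 x hx.1]
    · exact (CTRW.intervalIntegrable_density_mul hh_int (by fun_prop) (fun u => hMC _) 0 z).congr
        ((hinner n x hx z hz).symm.mono Set.uIoc_subset_uIcc)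
    · exact (CTRW.intervalIntegrable_quadrature (hJ_law 0) hh_meas hh_nonneg hJpos' (hτ_law n)
        hψ_meas hψ_nonneg hMm hMC hMb hv hx).congr
        ((houter n x hx ψ).symm.mono Set.uIoc_subset_uIcc)
    · rw [intervalIntegral.integral_congr (houter n x hx ψ), CTRW.meanExitTimeAfterJump,
        integral_congr_ae hae, hdec.2]
      congr 1
      refine intervalIntegral.integral_congr fun l hl => ?_
      rw [Set.uIcc_of_le (div_nonneg (by linarith [hx.2]) hv.le)] at hl
      simp only [CTRW.densityCDF]
      rw [CTRW.measureReal_Iic_of_density (hτ_law n) hψ_meas hψ_nonneg (hτpos' n) hl.1]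
  · have := hprob (hexc_m r hr)
    refine ⟨(CTRW.integrable_density (hexc_law r hr) (hpdf_m r) (hpdf_nn r hr)).intervalIntegrable,
      ?_⟩
    rw [CTRW.excessCDF_eq (hexc_m r hr), CTRW.measureReal_Iic_of_density (hexc_law r hr)
      (hpdf_m r) (hpdf_nn r hr) (hexc_pos r hr) hl]
  · have := hprob (hexc_m r hr)
    -- At an arbitrary present time, the waiting time is the excess life.
    have hdec := CTRW.integral_decomp_eq (hJ_law 0) hh_meas hh_nonneg hJpos' (hexc_law r hr)
      (hpdf_m r) (hpdf_nn r hr) (hexc_pos r hr)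
      (CTRW.aemeasurable_excessTriple hτ_meas hJ_meas hadm hr)
      (CTRW.map_excessTriple hτ_meas hJ_meas h_indep hadm hτpair hJpair hr)
      hF (CTRW.pathExit_nonneg v b) (CTRW.pathExit_le hv b)
      (fun p y hy => CTRW.pathExit_of_le p hy) hv hx
    have hae : CTRW.exitTime v b τ J r x =ᵐ[P] fun ω =>
        min (CTRW.excessLife τ r ω) ((b - x) / v) +
        if CTRW.excessLife τ r ω < (b - x) / v then
          CTRW.pathExit v b (CTRW.pathAfter τ J (CTRW.jumpCount τ r ω + 1) ω)
            (x + v * CTRW.excessLife τ r ω + J (CTRW.jumpCount τ r ω) ω) else 0 := by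
      filter_upwards [hadm] with ω H
      obtain ⟨m, h1, h2⟩ := H.exists_between hr
      have he : 0 < CTRW.jumpTime τ (m + 1) ω - r := by linarith
      have hJ0 := H.jump_pos m
      have hx0 := hx.1
      rw [H.exitTime_decomp hv hx h1 h2, H.excessLife_eq h1 h2, H.jumpCount_eq h1 h2,
        H.exitTimeAfterJump_eq_pathExit hv (m + 1) (by positivity)]
    refine ⟨hdec.1.congr hae.symm, ?_, ?_, ?_⟩
    · have hmono : Monotone (CTRW.excessCDF P τ r) := fun s t hst =>
        measureReal_mono fun ω (hω : _ ≤ s) => hω.trans hst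
      exact intervalIntegrable_const.sub hmono.intervalIntegrable
    · exact (CTRW.intervalIntegrable_quadrature (hJ_law 0) hh_meas hh_nonneg hJpos'
        (hexc_law r hr) (hpdf_m r) (hpdf_nn r hr) hMm hMC hMb hv hx).congr
        ((houter n x hx _).symm.mono Set.uIoc_subset_uIcc)
    · rw [intervalIntegral.integral_congr (houter n x hx (CTRW.excessPDF P τ r)),
        CTRW.meanExitTime, integral_congr_ae hae, hdec.2]
      simp only [CTRW.excessCDF_eq (hexc_m r hr), hM]
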